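/- Proposition. For $r,s\ge 2$ let $\infty(r,s)$ be the digraph on $r+s-1$ vertices obtained from a directed cycle of length $r$ and a directed cycle of length $s$ by identifying one vertex of the first with one vertex of the second. The adjacency matrix of a digraph has entry $1$ at $(i,j)$ if there is an arc from $i$ to $j$, and $0$ otherwise; $P_D\in\mathbb{R}[x]$ denotes the characteristic polynomial of the adjacency matrix of $D$. The complementarity spectrum $\Pi(D)$ of a digraph $D$ with adjacency matrix $A$ is the set of all $\lambda\in\mathbb{R}$ for which there is a nonzero, entrywise nonnegative real vector $v$ such that $Av\ge\lambda v$ entrywise and $\langle v, Av-\lambda v\rangle=0$. Then for every integer $r\ge 2$: (a) $\Pi(\infty(r,5r))=\Pi(\infty(2r,3r))$; (b) $P_{\infty(r,5r)}(x)=\dfrac{x^{2r}-x^r+1}{x^r}\,P_{\infty(2r,3r)}(x)$ as rational functions over $\mathbb{R}$; (c) the polynomial $x^{2r}-x^r+1$ has no real roots. -/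

import Mathlib

/-- The complementarity spectrum of a real square matrix `A`: the set of all real `μ` for which
there is a nonzero vector `x ≥ 0` with `A x ≥ μ x` and `⟨x, A x - μ x⟩ = 0`. -/
def Matrix.complementaritySpectrum {n : Type*} [Fintype n] (A : Matrix n n ℝ) : Set ℝ :=
  {μ | ∃ x : n → ℝ, x ≠ 0 ∧ 0 ≤ x ∧ μ • x ≤ A.mulVec x ∧ x ⬝ᵥ (A.mulVec x - μ • x) = 0}

open Classical in
/-- The real adjacency matrix of a digraph: the entry `(u, v)` is `1` if there is an arc from `u`
to `v`, and `0` otherwise. -/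
noncomputable def Digraph.adjMatrix {V : Type*} (D : Digraph V) : Matrix V V ℝ :=
  Matrix.of fun u v => if D.Adj u v then 1 else 0

/-- The complementarity spectrum of a finite digraph is that of its adjacency matrix. -/
noncomputable def Digraph.complementaritySpectrum {V : Type*} [Fintype V] (D : Digraph V) :
    Set ℝ :=
  D.adjMatrix.complementaritySpectrum

/-- The characteristic polynomial of a finite digraph is that of its adjacency matrix. -/
noncomputable def Digraph.charpoly {V : Type*} [Fintype V] [DecidableEq V] (D : Digraph V) :
    Polynomial ℝ :=
  D.adjMatrix.charpoly

/-- The label in `inftyDigraph r s` of the vertex `j ∈ {0, …, s - 1}` of the second cycle: the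
vertex `0` is identified with the vertex `0` of the first cycle, and the vertices `1, …, s - 1`
become `r, …, r + s - 2`. -/
def inftyDigraph.sndLabel (r j : ℕ) : ℕ := if j = 0 then 0 else r - 1 + j

/-- The digraph `∞(r, s)` (for `r, s ≥ 2`): the coalescence of a directed cycle of length `r` and a
directed cycle of length `s`, which share exactly one vertex. The first cycle has the vertices
`0, …, r - 1`; the second one has the vertices `sndLabel r 0, …, sndLabel r (s - 1)`, that is
`0, r, …, r + s - 2`. There are `r + s - 1` vertices in total. -/
def inftyDigraph (r s : ℕ) : Digraph (Fin (r + s - 1)) where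
  Adj u v :=
    (∃ i < r, (u : ℕ) = i ∧ (v : ℕ) = (i + 1) % r) ∨
    (∃ j < s, (u : ℕ) = inftyDigraph.sndLabel r j ∧
      (v : ℕ) = inftyDigraph.sndLabel r ((j + 1) % s))

/-! For `t > 0`, a complementarity vector of ∞(r,s) spreads over one cycle, forcing `t = 1`, or over
both, forcing `t^(r+s) = t^r + t^s`; `0` always occurs and negative values never do. Up to a power
of x, the characteristic polynomial is x^(r+s) - x^r - x^s. With y = x^r this is y(y^2-y+1)(y^3-y-1)
for (r,5r) and y^2(y^3-y-1) for (2r,3r). The quotient is (y^2-y+1)/y, and y^2-y+1 is positive on the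
reals, so the positive roots agree. -/

/-- Cramer's rule, applied to a right-hand side that is a linear combination of the columns. -/
theorem Matrix.det_updateCol_mulVec {n R : Type*} [Fintype n] [DecidableEq n] [CommRing R]
    (M : Matrix n n R) (v : n → R) (i : n) :
    (M.updateCol i (M.mulVec v)).det = M.det * v i := by
  rw [← Matrix.cramer_apply, Matrix.cramer_eq_adjugate_mulVec, Matrix.mulVec_mulVec,
    Matrix.adjugate_mul, Matrix.smul_mulVec, Matrix.one_mulVec, Pi.smul_apply, smul_eq_mul]

/-! ### Arcs and the action of the adjacency matrix. -/

namespace inftyDigraph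

/-- The only out-neighbour of a vertex `u ≠ 0` of `inftyDigraph r s`. -/
def next (r s u : ℕ) : ℕ := if u = r - 1 ∨ u = r + s - 2 then 0 else u + 1

theorem adj_iff {r s : ℕ} (hr : 2 ≤ r) (hs : 2 ≤ s) (u v : Fin (r + s - 1)) :
    (inftyDigraph r s).Adj u v ↔
      ((u : ℕ) = 0 ∧ ((v : ℕ) = 1 ∨ (v : ℕ) = r)) ∨
        ((u : ℕ) ≠ 0 ∧ (v : ℕ) = next r s u) := by
  have succ_mod : ∀ {i m : ℕ}, i < m → (i + 1) % m = if i + 1 = m then 0 else i + 1 := by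
    intro i m h
    split_ifs with h'
    · rw [h', Nat.mod_self]
    · exact Nat.mod_eq_of_lt (by omega)
  have snd_succ : ∀ {j : ℕ}, j < s →
      sndLabel r ((j + 1) % s) = if j + 1 = s then 0 else r + j := by
    intro j hj
    rw [succ_mod hj, sndLabel]
    by_cases h : j + 1 = s
    · rw [if_pos h, if_pos rfl, if_pos h]
    · rw [if_neg h, if_neg (by omega), if_neg h]
      omega
  have hu := u.2
  constructor
  · rintro (⟨i, hi, h1, h2⟩ | ⟨j, hj, h1, h2⟩)
    · rw [succ_mod hi] at h2
      unfold next
      split_ifs at h2 ⊢ <;> omega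
    · rw [snd_succ hj] at h2
      unfold sndLabel at h1
      unfold next
      split_ifs at h1 h2 ⊢ <;> omega
  · intro h
    by_cases hfst : (u : ℕ) < r ∧ ¬ ((u : ℕ) = 0 ∧ (v : ℕ) = r)
    · refine Or.inl ⟨u, hfst.1, rfl, ?_⟩
      rw [succ_mod hfst.1]
      unfold next at h
      split_ifs at h ⊢ <;> omega
    · obtain ⟨j, hj, hju⟩ : ∃ j < s, (u : ℕ) = sndLabel r j := by
        by_cases hu0 : (u : ℕ) = 0
        · exact ⟨0, by omega, hu0⟩
        · refine ⟨u - (r - 1), by omega, ?_⟩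
          rw [sndLabel, if_neg (by omega)]
          omega
      refine Or.inr ⟨j, hj, hju, ?_⟩
      rw [snd_succ hj]
      unfold sndLabel at hju
      unfold next at h
      split_ifs at hju h ⊢ <;> omega

theorem next_lt {r s u : ℕ} (hu : u < r + s - 1) : next r s u < r + s - 1 := by
  unfold next
  split_ifs <;> omega

/-- The action of the adjacency matrix, with scalars extended along `f`. -/
theorem map_adjMatrix_mulVec {R : Type*} [CommRing R] (f : ℝ →+* R) {r s : ℕ} (hr : 2 ≤ r)
    (hs : 2 ≤ s) (y : ℕ → R) (u : Fin (r + s - 1)) :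
    ((inftyDigraph r s).adjMatrix.map f).mulVec (fun v => y v) u =
      if (u : ℕ) = 0 then y 1 + y r else y (next r s u) := by
  have entry : ∀ v, ((inftyDigraph r s).adjMatrix.map f) u v =
      if (u : ℕ) = 0 then (if v = ⟨1, by omega⟩ then 1 else 0) + (if v = ⟨r, by omega⟩ then 1 else 0)
      else if v = ⟨next r s u, next_lt u.2⟩ then 1 else 0 := by
    intro v
    simp only [Digraph.adjMatrix, Matrix.map_apply, Matrix.of_apply, adj_iff hr hs, Fin.ext_iff]
    split_ifs <;> first | omega | simp
  simp only [Matrix.mulVec, dotProduct, entry]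
  split_ifs <;> simp [add_mul, Finset.sum_add_distrib]

theorem adjMatrix_mulVec {r s : ℕ} (hr : 2 ≤ r) (hs : 2 ≤ s) (y : ℕ → ℝ)
    (u : Fin (r + s - 1)) :
    (inftyDigraph r s).adjMatrix.mulVec (fun v => y v) u =
      if (u : ℕ) = 0 then y 1 + y r else y (next r s u) := by
  rw [← map_adjMatrix_mulVec (RingHom.id ℝ) hr hs y u]
  congr

/-! ### Weight vector and characteristic polynomial. -/

/-- A vector on the vertices of `inftyDigraph r s` which the adjacency matrix scales by `t` at
all vertices other than `0`. -/
def weight {R : Type*} [CommRing R] (t : R) (r s i : ℕ) : R :=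
  if i = 0 then t ^ (r + s) else if i < r then t ^ (i + s) else t ^ (i + 1)

/-- The shifts `s` and `1` in the exponents give both last vertices, `r - 1` and `r + s - 2`, the
weight `t ^ (r + s - 1)`, so both cycles close up at vertex `0` without division. -/
theorem weight_next {R : Type*} [CommRing R] (t : R) {r s u : ℕ} (hr : 2 ≤ r) (hs : 2 ≤ s)
    (hu0 : u ≠ 0) : weight t r s (next r s u) = t * weight t r s u := by
  have hnext : weight t r s (next r s u) =
      if u < r then t ^ (u + 1 + s) else t ^ (u + 1 + 1) := by
    unfold next
    split_ifs with h1 h2 h2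
    · rw [weight, if_pos rfl]
      congr 1
      omega
    · rw [weight, if_pos rfl]
      congr 1
      omega
    · rw [weight, if_neg (by omega), if_pos (by omega)]
    · rw [weight, if_neg (by omega), if_neg (by omega)]
  rw [hnext, weight, if_neg hu0]
  split_ifs <;> ring

theorem weight_one_add_weight {R : Type*} [CommRing R] (t : R) {r s : ℕ} (hr : 2 ≤ r) :
    weight t r s 1 + weight t r s r = t ^ (s + 1) + t ^ (r + 1) := by
  unfold weight
  rw [if_neg one_ne_zero, if_pos (by omega), if_neg (by omega), if_neg (by omega), add_comm 1 s]

-- The characteristic matrix sends the weight vector to a multiple of the basis vector at `0`.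
-- Putting this image in column `0` leaves an upper triangular matrix, because every arc not ending
-- at `0` increases the label; Cramer's rule then gives the determinant.
open Polynomial in
theorem X_pow_mul_charpoly {r s : ℕ} (hr : 2 ≤ r) (hs : 2 ≤ s) :
    X ^ (r + s) * (inftyDigraph r s).charpoly =
      (X ^ (r + s + 1) - X ^ (s + 1) - X ^ (r + 1)) * X ^ (r + s - 2) := by
  let z : Fin (r + s - 1) := ⟨0, by omega⟩
  let M := (inftyDigraph r s).adjMatrix.charmatrix
  let v : Fin (r + s - 1) → ℝ[X] := fun i => weight X r s i
  have hMv : M.mulVec v = Pi.single z (X ^ (r + s + 1) - X ^ (s + 1) - X ^ (r + 1)) := by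
    funext u
    have hM : M.mulVec v u =
        X * v u - ((inftyDigraph r s).adjMatrix.map (C : ℝ →+* ℝ[X])).mulVec v u := by
      simp [M, Matrix.charmatrix, Matrix.sub_mulVec, Matrix.scalar_apply]
    rw [hM, map_adjMatrix_mulVec C hr hs (weight X r s) u]
    by_cases hu : u = z
    · subst hu
      rw [if_pos rfl, weight_one_add_weight X hr, Pi.single_eq_same]
      simp only [v, z, weight, if_true]
      ring
    · have hu0 : (u : ℕ) ≠ 0 := fun h => hu (Fin.ext h)
      rw [if_neg hu0, weight_next X hr hs hu0, Pi.single_eq_of_ne hu, sub_self]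
  have hdet := Matrix.det_updateCol_mulVec M v z
  have hvz : v z = X ^ (r + s) := by simp [v, z, weight]
  have htri : (M.updateCol z (M.mulVec v)).IsUpperTriangular := by
    intro i j hij
    have hij' : j < i := hij
    by_cases hj : j = z
    · subst hj
      rw [Matrix.updateCol_self, hMv, Pi.single_eq_of_ne hij'.ne']
    · have hj0 : (j : ℕ) ≠ 0 := fun h => hj (Fin.ext h)
      have hlt : (j : ℕ) < i := hij'
      rw [Matrix.updateCol_ne hj]
      refine (Matrix.charmatrix_apply_ne _ _ _ hij'.ne').trans ?_
      have hadj : ¬ (inftyDigraph r s).Adj i j := by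
        rw [adj_iff hr hs, next]
        split_ifs <;> omega
      simp [Digraph.adjMatrix, hadj]
  have hloop : ∀ i, ¬ (inftyDigraph r s).Adj i i := by
    intro i
    rw [adj_iff hr hs, next]
    split_ifs <;> omega
  rw [Matrix.det_of_isUpperTriangular htri, hvz, ← Finset.mul_prod_erase _ _ (Finset.mem_univ z),
    Matrix.updateCol_self, hMv, Pi.single_eq_same,
    Finset.prod_congr rfl (g := fun _ => (X : ℝ[X])), Finset.prod_const,
    Finset.card_erase_of_mem (Finset.mem_univ z), Finset.card_univ, Fintype.card_fin] at hdet
  · rw [mul_comm, show r + s - 2 = r + s - 1 - 1 by omega]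
    exact hdet.symm
  · intro i hi
    rw [Matrix.updateCol_ne (Finset.ne_of_mem_erase hi)]
    refine (Matrix.charmatrix_apply_eq _ _).trans ?_
    simp [Digraph.adjMatrix, hloop]

/-! ### Complementarity spectrum. -/

/-- A path along which a vector is multiplied by `t` at each step, as long as it does not vanish. -/
theorem pow_mul_eq_of_chain {y : ℕ → ℝ} {t : ℝ} (ht : 0 < t) {a e : ℕ}
    (h : ∀ u, a ≤ u → u < e → y u = 0 ∨ y (u + 1) = t * y u)
    (he : y e = 0 ∨ y 0 = t * y e) (k : ℕ) :
    ∀ u, a ≤ u → u + k = e → y u ≠ 0 → t ^ (k + 1) * y u = y 0 := by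
  induction k with
  | zero =>
    rintro u - rfl hy
    simpa using (he.resolve_left hy).symm
  | succ k ih =>
    intro u hau hu hy
    have hs := (h u hau (by omega)).resolve_left hy
    rw [← ih (u + 1) (by omega) (by omega) (by rw [hs]; exact mul_ne_zero ht.ne' hy), hs]
    ring

/-- The inner product is a sum of nonnegative terms, so it vanishes only termwise. -/
theorem _root_.Matrix.mem_complementaritySpectrum_iff {n : Type*} [Fintype n] {A : Matrix n n ℝ}
    {t : ℝ} : t ∈ A.complementaritySpectrum ↔ ∃ x : n → ℝ, x ≠ 0 ∧ (∀ i, 0 ≤ x i) ∧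
      ∀ i, t * x i ≤ A.mulVec x i ∧ (x i = 0 ∨ A.mulVec x i = t * x i) := by
  refine exists_congr fun x => and_congr_right fun _ => and_congr_right fun hx => ?_
  constructor
  · rintro ⟨h1, h2⟩ i
    have hi := (Finset.sum_eq_zero_iff_of_nonneg
      (fun i _ => mul_nonneg (hx i) (sub_nonneg.2 (h1 i)))).1 h2 i (Finset.mem_univ i)
    exact ⟨h1 i, (mul_eq_zero.1 hi).imp_right sub_eq_zero.1⟩
  · intro h
    refine ⟨fun i => (h i).1, Finset.sum_eq_zero fun i _ => ?_⟩
    rcases (h i).2 with h0 | h0 <;> simp [h0]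

/-- The complementarity spectrum of `∞(r, s)` consists of `0`, `1`, and the spectral radius. -/
theorem mem_complementaritySpectrum_iff {r s : ℕ} (hr : 2 ≤ r) (hs : 2 ≤ s) {t : ℝ} :
    t ∈ (inftyDigraph r s).complementaritySpectrum ↔
      t = 0 ∨ t = 1 ∨ (0 < t ∧ t ^ (r + s) = t ^ r + t ^ s) := by
  rw [Digraph.complementaritySpectrum, Matrix.mem_complementaritySpectrum_iff]
  have hz : 0 < r + s - 1 := by omega
  constructor
  · rintro ⟨x, hx0, hx, h⟩
    let y : ℕ → ℝ := fun i => if hi : i < r + s - 1 then x ⟨i, hi⟩ else 0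
    have hxy : x = fun v : Fin (r + s - 1) => y v := by
      funext v
      simp [y]
    have hy : ∀ i, 0 ≤ y i := by
      intro i
      simp only [y]
      split_ifs
      exacts [hx _, le_rfl]
    have H : ∀ u < r + s - 1, y u = 0 ∨ (if u = 0 then y 1 + y r else y (next r s u)) = t * y u := by
      intro u hu
      have := (h ⟨u, hu⟩).2
      rwa [hxy, adjMatrix_mulVec hr hs] at this
    have hex : ∃ u < r + s - 1, y u ≠ 0 := by
      obtain ⟨u, hu⟩ := Function.ne_iff.1 hx0
      exact ⟨u, u.2, by simpa [y] using hu⟩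
    clear_value y
    obtain ⟨u, hu, hyu⟩ := hex
    rcases lt_trichotomy t 0 with ht | ht | ht
    -- The adjacency matrix preserves nonnegativity, so `t` cannot be negative where `y` is nonzero.
    · have h1 : t * y u < 0 := mul_neg_of_neg_of_pos ht ((hy u).lt_of_ne' hyu)
      rw [← (H u hu).resolve_left hyu] at h1
      split_ifs at h1
      · linarith [hy 1, hy r]
      · linarith [hy (next r s u)]
    · exact Or.inl ht
    refine Or.inr ?_
    have H' : ∀ u < r + s - 1, u ≠ 0 → y u = 0 ∨ y (next r s u) = t * y u := by
      intro u hu hu0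
      simpa only [if_neg hu0] using H u hu
    have hfst := pow_mul_eq_of_chain (y := y) ht (a := 1) (e := r - 1)
      (fun u h1 h2 => by
        have := H' u (by omega) (by omega)
        rwa [next, if_neg (by omega)] at this)
      (by
        have := H' (r - 1) (by omega) (by omega)
        rwa [next, if_pos (Or.inl rfl)] at this)
    have hsnd := pow_mul_eq_of_chain (y := y) ht (a := r) (e := r + s - 2)
      (fun u h1 h2 => by
        have := H' u (by omega) (by omega)
        rwa [next, if_neg (by omega)] at this)
      (by
        have := H' (r + s - 2) (by omega) (by omega)
        rwa [next, if_pos (Or.inr rfl)] at this)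
    -- Following arcs from any vertex of the support leads to the shared vertex.
    have hy0 : y 0 ≠ 0 := by
      rcases Nat.eq_zero_or_pos u with rfl | hu0
      · exact hyu
      rcases lt_or_ge u r with hur | hur
      · rw [← hfst (r - 1 - u) u hu0 (by omega) hyu]
        exact mul_ne_zero (pow_ne_zero _ ht.ne') hyu
      · rw [← hsnd (r + s - 2 - u) u hur (by omega) hyu]
        exact mul_ne_zero (pow_ne_zero _ ht.ne') hyu
    have hsum : y 1 + y r = t * y 0 := by simpa using (H 0 hz).resolve_left hy0
    have h1 : y 1 ≠ 0 → t ^ (r - 1) * y 1 = y 0 := fun h => by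
      have := hfst (r - 2) 1 le_rfl (by omega) h
      rwa [show r - 2 + 1 = r - 1 by omega] at this
    have h2 : y r ≠ 0 → t ^ (s - 1) * y r = y 0 := fun h => by
      have := hsnd (s - 2) r le_rfl (by omega) h
      rwa [show s - 2 + 1 = s - 1 by omega] at this
    have er : t ^ r = t ^ (r - 1) * t := (pow_sub_one_mul (by omega) t).symm
    have es : t ^ s = t ^ (s - 1) * t := (pow_sub_one_mul (by omega) t).symm
    -- Which cycles the support follows out of `0`: none is impossible, exactly one gives `t = 1`,
    -- both give the equation.
    by_cases hy1 : y 1 = 0 <;> by_cases hyr : y r = 0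
    · rw [hy1, hyr, add_zero] at hsum
      exact absurd hsum.symm (mul_ne_zero ht.ne' hy0)
    · left
      have : t ^ s = 1 := mul_right_cancel₀ hy0 (by
        rw [es, mul_assoc, ← hsum, hy1, zero_add, h2 hyr, one_mul])
      exact (pow_eq_one_iff_of_nonneg ht.le (by omega)).1 this
    · left
      have : t ^ r = 1 := mul_right_cancel₀ hy0 (by
        rw [er, mul_assoc, ← hsum, hyr, add_zero, h1 hy1, one_mul])
      exact (pow_eq_one_iff_of_nonneg ht.le (by omega)).1 this
    · refine Or.inr ⟨ht, mul_right_cancel₀ hy0 ?_⟩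
      rw [pow_add, er, es]
      linear_combination (-(t ^ (r - 1) * t ^ (s - 1) * t)) * hsum +
        t ^ (s - 1) * t * h1 hy1 + t ^ (r - 1) * t * h2 hyr
  · rintro (rfl | rfl | ⟨ht, h⟩)
    -- The shared vertex carries no loop, so its indicator realizes `0`.
    · refine ⟨fun v => if (v : ℕ) = 0 then 1 else 0, ?_, ?_, ?_⟩
      · exact Function.ne_iff.2 ⟨⟨0, hz⟩, by simp⟩
      · intro i
        dsimp only
        split_ifs <;> norm_num
      · intro i
        rw [adjMatrix_mulVec hr hs (fun v => if v = 0 then 1 else 0) i]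
        dsimp only
        split_ifs <;> first | omega | (norm_num <;> omega)
    -- On the first cycle its indicator is fixed; elsewhere only the inequality is needed.
    · refine ⟨fun v => if (v : ℕ) < r then 1 else 0, ?_, ?_, ?_⟩
      · exact Function.ne_iff.2 ⟨⟨0, hz⟩, by simp; omega⟩
      · intro i
        dsimp only
        split_ifs <;> norm_num
      · intro i
        rw [adjMatrix_mulVec hr hs (fun v => if v < r then 1 else 0) i, next]
        dsimp only
        split_ifs <;> first | omega | norm_num
    · have hpos : ∀ i, 0 < weight t r s i := by
        intro i
        unfold weight
        split_ifs <;> positivity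
      refine ⟨fun v => weight t r s v, ?_, fun i => (hpos i).le, ?_⟩
      · exact Function.ne_iff.2 ⟨⟨0, hz⟩, (hpos 0).ne'⟩
      · intro i
        have heq : (inftyDigraph r s).adjMatrix.mulVec (fun v => weight t r s v) i =
            t * weight t r s i := by
          rw [adjMatrix_mulVec hr hs]
          split_ifs with hi
          · rw [weight_one_add_weight t hr, hi, weight, if_pos rfl, h]
            ring
          · exact weight_next t hr hs hi
        exact ⟨heq.ge, Or.inr heq⟩

end inftyDigraph

/-! ### Comparing (r,5r) with (2r,3r). -/

theorem mainTheorem7 (r : ℕ) (hr : 2 ≤ r) :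
    (inftyDigraph r (5 * r)).complementaritySpectrum =
        (inftyDigraph (2 * r) (3 * r)).complementaritySpectrum ∧
      algebraMap (Polynomial ℝ) (RatFunc ℝ) (inftyDigraph r (5 * r)).charpoly =
        ((RatFunc.X : RatFunc ℝ) ^ (2 * r) - RatFunc.X ^ r + 1) / RatFunc.X ^ r *
          algebraMap (Polynomial ℝ) (RatFunc ℝ) (inftyDigraph (2 * r) (3 * r)).charpoly ∧
      ∀ x : ℝ, x ^ (2 * r) - x ^ r + 1 ≠ 0 := by
  refine ⟨?_, ?_, ?_⟩
  · ext t
    rw [inftyDigraph.mem_complementaritySpectrum_iff hr (by omega),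
      inftyDigraph.mem_complementaritySpectrum_iff (by omega) (by omega)]
    refine or_congr_right (or_congr_right (and_congr_right fun ht => ?_))
    have hy : 0 < t ^ r := pow_pos ht r
    have e1 : t ^ (r + 5 * r) = (t ^ r) ^ 6 := by ring
    have e2 : t ^ (5 * r) = (t ^ r) ^ 5 := by ring
    have e3 : t ^ (2 * r + 3 * r) = (t ^ r) ^ 5 := by ring
    have e4 : t ^ (2 * r) = (t ^ r) ^ 2 := by ring
    have e5 : t ^ (3 * r) = (t ^ r) ^ 3 := by ring
    rw [e1, e2, e3, e4, e5]
    generalize t ^ r = y at hy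
    have hq : y ^ 2 - y + 1 ≠ 0 := by nlinarith [sq_nonneg (y - 1)]
    constructor
    -- Here y(y^6-y^5-y) = (y^2-y+1)(y^5-y^2-y^3), and both multipliers are nonzero.
    · intro h
      refine mul_left_cancel₀ hq ?_
      linear_combination y * h
    · intro h
      refine mul_left_cancel₀ hy.ne' ?_
      linear_combination (y ^ 2 - y + 1) * h
  · have hX : (RatFunc.X : RatFunc ℝ) ≠ 0 := RatFunc.X_ne_zero
    have h1 := congrArg (algebraMap (Polynomial ℝ) (RatFunc ℝ))
      (inftyDigraph.X_pow_mul_charpoly hr (s := 5 * r) (by omega))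
    have h2 := congrArg (algebraMap (Polynomial ℝ) (RatFunc ℝ))
      (inftyDigraph.X_pow_mul_charpoly (r := 2 * r) (s := 3 * r) (by omega) (by omega))
    simp only [map_mul, map_sub, map_pow, RatFunc.algebraMap_X] at h1 h2
    -- Exposes a common power `X ^ k` in both formulas despite the truncated subtraction.
    rw [show r + 5 * r - 2 = (2 * r + 3 * r - 2) + r by omega] at h1
    generalize 2 * r + 3 * r - 2 = k at h1 h2
    rw [div_mul_eq_mul_div, eq_div_iff (pow_ne_zero r hX)]
    refine mul_left_cancel₀ (pow_ne_zero (r + 5 * r) hX) ?_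
    linear_combination RatFunc.X ^ r * h1 -
      (RatFunc.X ^ (2 * r) - RatFunc.X ^ r + 1) * RatFunc.X ^ r * h2
  · intro x
    rw [mul_comm, pow_mul]
    nlinarith [sq_nonneg (x ^ r - 1 / 2)]
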